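/- Let $\Lambda$ be a nontrivial finitely generated torsion-free nilpotent group and let $d\ge 1$. Let $\mathbb Z^d\wr\Lambda=\big(\bigoplus_{\Lambda}\mathbb Z^d\big)\rtimes\Lambda$ be the wreath product, in which $\Lambda$ acts on the group of finitely supported functions $f:\Lambda\to\mathbb Z^d$ by $(\gamma\cdot f)(x)=f(\gamma^{-1}x)$. Then $\Gamma=\mathbb Z^d\wr\Lambda$ admits an action by homeomorphisms on the Cantor space $X=\{0,1\}^{\mathbb N}$ that is minimal, topologically free and profinite, but not almost finite. Here an action of $\Gamma$ on $X$ is - minimal if every orbit is dense; - topologically free if the set of points with trivial stabilizer is comeager; - profinite if every clopen subset of $X$ has only finitely many $\Gamma$-translates; - almost finite if for every nonempty finite set $K\subseteq\Gamma$ and every $\varepsilon>0$ there are $n\in\mathbb N$, clopen sets $V_1,\dots,V_n\subseteq X$ and finite sets $S_1,\dots,S_n\subseteq\Gamma$ such that the sets $sV_i$ ($1\le i\le n$, $s\in S_i$) are pairwise disjoint and cover $X$, and $|KS_i\,\triangle\,S_i|<\varepsilon|S_i|$ for all $i$. -/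

import Mathlib

section WreathProduct

/-- The action of `Λ` on the direct sum `⨁_Λ A` (finitely supported functions `Λ → A`)
by shifting the copies of `A`: `(γ · f)(x) = f (γ⁻¹ * x)`. The direct sum is written
multiplicatively, so that the semidirect product can be formed. -/
noncomputable def wreathShift (A Λ : Type*) [AddCommGroup A] [Group Λ] :
    Λ →* MulAut (Multiplicative (Λ →₀ A)) where
  toFun γ := AddEquiv.toMultiplicative (Finsupp.domCongr (Equiv.mulLeft γ))
  map_one' := by
    refine MulEquiv.ext fun f => Multiplicative.toAdd.injective (Finsupp.ext fun x => ?_)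
    simp [Equiv.Perm.one_def]
  map_mul' γ δ := by
    refine MulEquiv.ext fun f => Multiplicative.toAdd.injective (Finsupp.ext fun x => ?_)
    simp [Equiv.Perm.mul_def]

theorem wreathShift_apply {A Λ : Type*} [AddCommGroup A] [Group Λ] (γ : Λ)
    (f : Multiplicative (Λ →₀ A)) (x : Λ) :
    (wreathShift A Λ γ f).toAdd x = f.toAdd (γ⁻¹ * x) := by
  simp [wreathShift]

/-- The (restricted) wreath product `A ≀ Λ = (⨁_Λ A) ⋊ Λ` of an abelian group `A`, written
additively, by a group `Λ`; the group law is
`(f, γ) (f', γ') = (f + f' (γ⁻¹ * ·), γ * γ')`. -/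
abbrev WreathProduct (A Λ : Type*) [AddCommGroup A] [Group Λ] :=
  Multiplicative (Λ →₀ A) ⋊[wreathShift A Λ] Λ

theorem WreathProduct.mul_left_apply {A Λ : Type*} [AddCommGroup A] [Group Λ]
    (a b : WreathProduct A Λ) (x : Λ) :
    (a * b).left.toAdd x = a.left.toAdd x + b.left.toAdd (a.right⁻¹ * x) := by
  simp [wreathShift_apply]

end WreathProduct

section Actions

/-- The set of points with trivial stabilizer is comeager. -/
def IsTopologicallyFree (Γ X : Type*) [Group Γ] [TopologicalSpace X] [MulAction Γ X] : Prop :=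
  {x : X | MulAction.stabilizer Γ x = ⊥} ∈ residual X

open scoped Pointwise in
/-- Every clopen set has only finitely many translates. -/
def IsProfiniteAction (Γ X : Type*) [Group Γ] [TopologicalSpace X] [MulAction Γ X] : Prop :=
  ∀ U : Set X, IsClopen U → (MulAction.orbit Γ U).Finite

open scoped Pointwise in
/-- Almost finiteness of an action on a zero-dimensional compact metrizable space: for every
nonempty finite `K ⊆ Γ` and every `ε > 0`, the space is the disjoint union of finitely many
clopen towers `⨆ s ∈ S i, s • V i` whose shapes satisfy `|K S i ∆ S i| < ε |S i|`.
(For `K = ∅` and `ε ≤ 1` the last inequality can never hold, so `K` is taken nonempty.) -/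
def IsAlmostFinite (Γ X : Type*) [Group Γ] [TopologicalSpace X] [MulAction Γ X] : Prop :=
  ∀ K : Finset Γ, K.Nonempty → ∀ ε : ℝ, 0 < ε →
    ∃ (n : ℕ) (V : Fin n → Set X) (S : Fin n → Finset Γ),
      (∀ i, IsClopen (V i)) ∧
      (Pairwise fun p q : Σ i : Fin n, {s : Γ // s ∈ S i} =>
        Disjoint ((p.2 : Γ) • V p.1) ((q.2 : Γ) • V q.1)) ∧
      (∀ i, ((symmDiff ((K : Set Γ) * (S i : Set Γ)) (S i : Set Γ)).ncard : ℝ)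
        < ε * ((S i).card : ℝ)) ∧
      ⋃ i, ⋃ s ∈ S i, s • V i = Set.univ

end Actions

/-! For a decreasing chain `H n` of finite-index subgroups of Γ with trivial intersection, Γ acts on
the inverse limit of the `Γ ⧸ H n`. This is a Cantor space, and the action is minimal and profinite.
It is topologically free because the base point has trivial stabilizer and a dense orbit
(`IsCosetTower.isTopologicallyFree`).

Almost finiteness fails as soon as some `g ≠ 1` fixes at least half of every `Γ ⧸ H n`. Clopen
towers descend to some finite level, and there a point fixed by `g` must lie in a level `s • V` with
`g * s` outside the shape. Shapes almost invariant under `g` leave room for few such points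
(`card_fixed_le_of_towers`).

For the wreath product, let `H n` consist of the `(f, γ)` such that, for every `k < n`, `γ ∈ L k`
and the sum of `f` over the single coset `c k L k` lies in `B k`. Each element of Λ occurs
infinitely often among the `c k`, while `L k` and `B k` eventually avoid any given nontrivial
element, so the intersection is trivial (`iInf_cosetSumChain`). Let `g` be a function supported at
one point. Its conjugates by Γ are again supported at one point, and condition `k` sees such a
conjugate only when that point lies in `c k L k`, which has density at most `2 ^ -(k + 2)`. The
total loss is at most 1/2 (`le_ncard_fixed_cosetSumChain`).

The `L k` exist because finitely generated nilpotent groups are residually finite; torsion-freeness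
makes Λ infinite, so the indices can grow as required. -/

/-! ### Brouwer's characterization of the Cantor space. -/

section Brouwer

variable {X : Type*} (U : ℕ → Set X)

/-- The least index `j` for which `U j` cuts `T` in two nonempty parts (`0` if there is none). -/
noncomputable def leastSplit (T : Set X) : ℕ :=
  sInf {j | (T ∩ U j).Nonempty ∧ (T \ U j).Nonempty}

/-- The set reached from `univ` after following the first `n` choices of `b`. -/
noncomputable def splitCell (b : ℕ → Bool) : ℕ → Set X
  | 0 => Set.univ
  | n + 1 => splitCell b n ∩
      {x | x ∈ U (leastSplit U (splitCell b n)) ↔ b n = true}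

theorem splitCell_antitone (b : ℕ → Bool) : Antitone (splitCell U b) :=
  antitone_nat_of_succ_le fun _ => Set.inter_subset_left

theorem splitCell_congr {b c : ℕ → Bool} {n : ℕ} (h : ∀ i < n, b i = c i) :
    splitCell U b n = splitCell U c n := by
  induction n with
  | zero => rfl
  | succ n ih => simp only [splitCell, ih fun i hi => h i (by omega), h n (by omega)]

/-- The cell containing `x` after `n` choices. -/
noncomputable def splitCellOf (x : X) : ℕ → Set X
  | 0 => Set.univ
  | n + 1 => splitCellOf x n ∩
      {y | y ∈ U (leastSplit U (splitCellOf x n)) ↔ x ∈ U (leastSplit U (splitCellOf x n))}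

open Classical in
/-- The sequence of choices leading to `x`. -/
noncomputable def splitCode (x : X) (n : ℕ) : Bool :=
  decide (x ∈ U (leastSplit U (splitCellOf U x n)))

theorem splitCell_splitCode (x : X) (n : ℕ) :
    splitCell U (splitCode U x) n = splitCellOf U x n := by
  induction n with
  | zero => rfl
  | succ n ih =>
    simp only [splitCell, splitCellOf, ih, splitCode, decide_eq_true_eq]

theorem mem_splitCell_splitCode (x : X) (n : ℕ) : x ∈ splitCell U (splitCode U x) n := by
  rw [splitCell_splitCode]
  induction n with
  | zero => trivial
  | succ n ih => exact ⟨ih, Iff.rfl⟩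

theorem splitCode_eq_of_mem {x : X} {b : ℕ → Bool} {n : ℕ} (h : x ∈ splitCell U b n) :
    ∀ i < n, splitCode U x i = b i := by
  induction n with
  | zero => intro i hi; omega
  | succ n ih =>
    intro i hi
    rcases Nat.lt_succ_iff_lt_or_eq.1 hi with hi | rfl
    · exact ih h.1 i hi
    · have h2 := h.2
      rw [splitCode, ← splitCell_splitCode, splitCell_congr U (ih h.1), Bool.eq_iff_iff]
      simpa using! h2

/-- Cutting always at the least splitting index leaves no index behind: once all indices below `n`
have stopped splitting, `n` is either harmless or the one cut next. -/
theorem splitCell_not_split (b : ℕ → Bool) {n j : ℕ} (hj : j < n) :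
    ¬ ((splitCell U b n ∩ U j).Nonempty ∧ (splitCell U b n \ U j).Nonempty) := by
  induction n generalizing j with
  | zero => omega
  | succ n ih =>
    rintro ⟨⟨x, hx, hxj⟩, ⟨y, hy, hyj⟩⟩
    have hmem : n ∈ {j | (splitCell U b n ∩ U j).Nonempty ∧ (splitCell U b n \ U j).Nonempty} := by
      rcases Nat.lt_succ_iff_lt_or_eq.1 hj with h | rfl
      · exact absurd ⟨⟨x, hx.1, hxj⟩, ⟨y, hy.1, hyj⟩⟩ (ih h)
      · exact ⟨⟨x, hx.1, hxj⟩, ⟨y, hy.1, hyj⟩⟩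
    have hjn : j = n := by
      by_contra h
      exact ih (by omega) ⟨⟨x, hx.1, hxj⟩, ⟨y, hy.1, hyj⟩⟩
    subst hjn
    have hls : leastSplit U (splitCell U b j) = j := by
      refine le_antisymm (Nat.sInf_le hmem) ?_
      by_contra hlt
      exact ih (not_le.1 hlt) (Nat.sInf_mem ⟨j, hmem⟩)
    have h1 := hx.2
    have h2 := hy.2
    rw [hls] at h1 h2
    exact hyj (h2.2 (h1.1 hxj))

variable [TopologicalSpace X]

theorem isClopen_splitCell (hU : ∀ n, IsClopen (U n)) (b : ℕ → Bool) (n : ℕ) :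
    IsClopen (splitCell U b n) := by
  induction n with
  | zero => exact isClopen_univ
  | succ n ih =>
    refine ih.inter ?_
    cases hb : b n
    · simpa [Set.compl_def] using! (hU (leastSplit U (splitCell U b n))).compl
    · simpa using! hU (leastSplit U (splitCell U b n))

/-- A nonempty cell is open, so it has two points, and some `U j` separates them. The least
splitting index is therefore genuine, not the default 0, and both halves are nonempty. -/
theorem splitCell_nonempty [Nonempty X] (hU : ∀ n, IsClopen (U n))
    (hsep : ∀ x y, (∀ n, x ∈ U n ↔ y ∈ U n) → x = y)
    (hperf : ∀ V : Set X, IsOpen V → V.Nonempty → V.Nontrivial) (b : ℕ → Bool) (n : ℕ) :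
    (splitCell U b n).Nonempty := by
  induction n with
  | zero => exact Set.univ_nonempty
  | succ n ih =>
    obtain ⟨x, hx, y, hy, hxy⟩ := hperf _ (isClopen_splitCell U hU b n).isOpen ih
    have hne : {j | (splitCell U b n ∩ U j).Nonempty ∧ (splitCell U b n \ U j).Nonempty}.Nonempty := by
      by_contra hem
      refine hxy (hsep x y fun j => ?_)
      by_contra hj
      refine hem ⟨j, ?_⟩
      by_cases hxj : x ∈ U j <;> by_cases hyj : y ∈ U j
      · simp [hxj, hyj] at hj
      · exact ⟨⟨x, hx, hxj⟩, ⟨y, hy, hyj⟩⟩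
      · exact ⟨⟨y, hy, hyj⟩, ⟨x, hx, hxj⟩⟩
      · simp [hxj, hyj] at hj
    obtain ⟨⟨z, hz, hzj⟩, ⟨w, hw, hwj⟩⟩ := Nat.sInf_mem hne
    cases hb : b n
    · exact ⟨w, hw, by simpa [hb, leastSplit] using hwj⟩
    · exact ⟨z, hz, by simpa [hb, leastSplit] using hzj⟩

/-- **Brouwer's theorem** on the Cantor space. -/
theorem nonempty_homeomorph_cantor [Nonempty X] [CompactSpace X] (hU : ∀ n, IsClopen (U n))
    (hsep : ∀ x y, (∀ n, x ∈ U n ↔ y ∈ U n) → x = y)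
    (hperf : ∀ V : Set X, IsOpen V → V.Nonempty → V.Nontrivial) :
    Nonempty (X ≃ₜ (ℕ → Bool)) := by
  have hcont : Continuous (splitCode U) := by
    refine continuous_pi fun n => continuous_discrete_rng.2 fun t => ?_
    rw [isOpen_iff_mem_nhds]
    intro x hx
    filter_upwards [(isClopen_splitCell U hU (splitCode U x) (n + 1)).isOpen.mem_nhds
      (mem_splitCell_splitCode U x _)] with y hy
    rw [Set.mem_preimage, splitCode_eq_of_mem U hy n (by omega)]
    exact hx
  have hinj : Function.Injective (splitCode U) := by
    intro x y hxy
    refine hsep x y fun j => ?_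
    have hx := mem_splitCell_splitCode U x (j + 1)
    have hy := mem_splitCell_splitCode U y (j + 1)
    rw [← hxy] at hy
    have := splitCell_not_split U (splitCode U x) (Nat.lt_succ_self j)
    by_contra hj
    refine this ?_
    by_cases hxj : x ∈ U j <;> by_cases hyj : y ∈ U j
    · simp [hxj, hyj] at hj
    · exact ⟨⟨x, hx, hxj⟩, ⟨y, hy, hyj⟩⟩
    · exact ⟨⟨y, hy, hyj⟩, ⟨x, hx, hxj⟩⟩
    · simp [hxj, hyj] at hj
  have hsurj : Function.Surjective (splitCode U) := by
    intro b
    obtain ⟨x, hx⟩ := IsCompact.nonempty_iInter_of_sequence_nonempty_isCompact_isClosed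
      (splitCell U b) (fun n => splitCell_antitone U b (Nat.le_succ n))
      (splitCell_nonempty U hU hsep hperf b) isCompact_univ
      (fun n => (isClopen_splitCell U hU b n).isClosed)
    refine ⟨x, funext fun n => ?_⟩
    exact splitCode_eq_of_mem U (Set.mem_iInter.1 hx (n + 1)) n (by omega)
  exact ⟨Continuous.homeoOfEquivCompactToT2 (f := Equiv.ofBijective _ ⟨hinj, hsurj⟩) hcont⟩

end Brouwer

/-! ### Profinite actions from chains of finite-index subgroups. -/

section Tower

open Pointwise

variable {Γ : Type*} [Group Γ] (H : ℕ → Subgroup Γ)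

/-- The inverse limit of the coset spaces `Γ ⧸ H n` of a sequence of subgroups. -/
@[ext]
structure CosetLimit where
  coord : ∀ n, Γ ⧸ H n
  exists_rep : ∀ m n, m ≤ n → ∃ γ : Γ, coord m = γ ∧ coord n = γ

namespace CosetLimit

/-- The discrete topology on each factor is passed explicitly, since Γ carries no topology. -/
instance : TopologicalSpace (CosetLimit H) :=
  TopologicalSpace.induced (fun x => x.coord) (@Pi.topologicalSpace _ _ fun _ => ⊥)

instance : MulAction Γ (CosetLimit H) where
  smul γ x := ⟨fun n => γ • x.coord n, fun m n h => by
    obtain ⟨δ, h1, h2⟩ := x.exists_rep m n h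
    exact ⟨γ * δ, congrArg (γ • ·) h1, congrArg (γ • ·) h2⟩⟩
  one_smul x := CosetLimit.ext (funext fun n => one_smul Γ (x.coord n))
  mul_smul a b x := CosetLimit.ext (funext fun n => mul_smul a b (x.coord n))

instance : Nonempty (CosetLimit H) := ⟨⟨fun _ => ((1 : Γ) : Γ ⧸ _), fun _ _ _ => ⟨1, rfl, rfl⟩⟩⟩

theorem isOpen_cylinder (n : ℕ) (q : Γ ⧸ H n) : IsOpen {x : CosetLimit H | x.coord n = q} := by
  let _ : ∀ n, TopologicalSpace (Γ ⧸ H n) := fun _ => ⊥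
  have : ∀ n, DiscreteTopology (Γ ⧸ H n) := fun _ => ⟨rfl⟩
  exact isOpen_induced_iff.2 ⟨(fun x : ∀ n, Γ ⧸ H n => x n) ⁻¹' {q},
    (isOpen_discrete {q}).preimage (continuous_apply n), rfl⟩

theorem eq_of_le (hH : Antitone H) {x y : CosetLimit H} {m n : ℕ} (hmn : m ≤ n)
    (h : x.coord n = y.coord n) : x.coord m = y.coord m := by
  obtain ⟨γ, h1, h2⟩ := x.exists_rep m n hmn
  obtain ⟨δ, h3, h4⟩ := y.exists_rep m n hmn
  rw [h2, h4, QuotientGroup.eq] at h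
  rw [h1, h3, QuotientGroup.eq]
  exact hH hmn h

theorem exists_cylinder_subset (hH : Antitone H) {U : Set (CosetLimit H)} (hU : IsOpen U)
    {x : CosetLimit H} (hx : x ∈ U) : ∃ n, {y : CosetLimit H | y.coord n = x.coord n} ⊆ U := by
  let _ : ∀ n, TopologicalSpace (Γ ⧸ H n) := fun _ => ⊥
  obtain ⟨V, hV, rfl⟩ := isOpen_induced_iff.1 hU
  obtain ⟨I, u, hu, hIu⟩ := isOpen_pi_iff.1 hV x.coord hx
  refine ⟨I.sup id, fun y hy => hIu fun i hi => ?_⟩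
  have := eq_of_le H hH (Finset.le_sup (f := id) hi) hy
  exact (congrArg (· ∈ u i) this).mpr (hu i hi).2

/-- The limit is closed in a product of finite discrete spaces, as each compatibility condition
involves only two coordinates. -/
theorem compactSpace [hf : ∀ n, (H n).FiniteIndex] : CompactSpace (CosetLimit H) := by
  let _ : ∀ n, TopologicalSpace (Γ ⧸ H n) := fun _ => ⊥
  have : ∀ n, DiscreteTopology (Γ ⧸ H n) := fun _ => ⟨rfl⟩
  refine isCompact_univ_iff.1 ?_
  have hind : Topology.IsInducing (fun x : CosetLimit H => x.coord) := ⟨rfl⟩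
  rw [hind.isCompact_iff, Set.image_univ]
  refine IsClosed.isCompact ?_
  have : Set.range (fun x : CosetLimit H => x.coord) =
      ⋂ m, ⋂ n, ⋂ _ : m ≤ n, {x : ∀ n, Γ ⧸ H n | ∃ γ : Γ, x m = γ ∧ x n = γ} := by
    ext x
    simp only [Set.mem_iInter]
    exact ⟨fun ⟨y, hy⟩ => hy ▸ y.exists_rep, fun h => ⟨⟨x, h⟩, rfl⟩⟩
  rw [this]
  refine isClosed_iInter fun m => isClosed_iInter fun n => isClosed_iInter fun _ => ?_
  have hcont : Continuous fun x : ∀ n, Γ ⧸ H n => (x m, x n) :=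
    (continuous_apply m).prodMk (continuous_apply n)
  exact (isClosed_discrete {p : (Γ ⧸ H m) × (Γ ⧸ H n) | ∃ γ : Γ, p.1 = γ ∧ p.2 = γ}).preimage
    hcont

end CosetLimit

/-- An action on a space `Y` together with compatible equivariant maps to the coset spaces `Γ ⧸ H n`
whose fibres form a basis of the topology, and a point `y₀` mapped to the trivial cosets. -/
structure IsCosetTower (Y : Type*) [TopologicalSpace Y] [MulAction Γ Y]
    (π : ∀ n, Y → Γ ⧸ H n) (y₀ : Y) : Prop where
  map_smul : ∀ n (γ : Γ) y, π n (γ • y) = γ • π n y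
  isOpen_fiber : ∀ n q, IsOpen (π n ⁻¹' {q})
  exists_fiber_subset : ∀ (U : Set Y), IsOpen U → ∀ y ∈ U, ∃ n, π n ⁻¹' {π n y} ⊆ U
  eq_of_le : ∀ m n, m ≤ n → ∀ x y, π n x = π n y → π m x = π m y
  map_base : ∀ n, π n y₀ = ((1 : Γ) : Γ ⧸ H n)

namespace IsCosetTower

variable {H} {Y : Type*} [TopologicalSpace Y] [MulAction Γ Y] {π : ∀ n, Y → Γ ⧸ H n} {y₀ : Y}

theorem map_smul_base (h : IsCosetTower H Y π y₀) (n : ℕ) (γ : Γ) : π n (γ • y₀) = γ := by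
  rw [h.map_smul, h.map_base]; simp

theorem surjective (h : IsCosetTower H Y π y₀) (n : ℕ) : Function.Surjective (π n) := fun q => by
  obtain ⟨γ, rfl⟩ := QuotientGroup.mk_surjective q
  exact ⟨_, h.map_smul_base n γ⟩

theorem isOpen_preimage (h : IsCosetTower H Y π y₀) (n : ℕ) (W : Set (Γ ⧸ H n)) :
    IsOpen (π n ⁻¹' W) := by
  rw [← Set.biUnion_preimage_singleton]
  exact isOpen_biUnion fun q _ => h.isOpen_fiber n q

theorem continuousConstSMul (h : IsCosetTower H Y π y₀) : ContinuousConstSMul Γ Y := by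
  refine ⟨fun γ => continuous_def.2 fun U hU => isOpen_iff_mem_nhds.2 fun y hy => ?_⟩
  obtain ⟨n, hn⟩ := h.exists_fiber_subset U hU _ hy
  filter_upwards [(h.isOpen_fiber n (π n y)).mem_nhds rfl] with z hz
  refine hn ?_
  simp only [Set.mem_preimage, Set.mem_singleton_iff] at hz ⊢
  rw [h.map_smul, h.map_smul, hz]

theorem isMinimal (h : IsCosetTower H Y π y₀) : MulAction.IsMinimal Γ Y := by
  refine ⟨fun x => dense_iff_inter_open.2 fun U hU ⟨y, hy⟩ => ?_⟩
  obtain ⟨n, hn⟩ := h.exists_fiber_subset U hU y hy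
  obtain ⟨γ, hγ⟩ := MulAction.exists_smul_eq Γ (π n x) (π n y)
  exact ⟨γ • x, hn (by simp [h.map_smul, hγ]), γ, rfl⟩

theorem exists_smul_base_ne (h : IsCosetTower H Y π y₀) (hbot : ⨅ n, H n = ⊥) {γ : Γ}
    (hγ : γ ≠ 1) : ∃ n, π n (γ • y₀) ≠ π n y₀ := by
  by_contra! hc
  refine hγ ?_
  rw [← Subgroup.mem_bot, ← hbot, Subgroup.mem_iInf]
  intro n
  have := hc n
  rw [h.map_smul_base, h.map_base, eq_comm, QuotientGroup.eq] at this
  simpa using this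

theorem smul_base_ne (h : IsCosetTower H Y π y₀) (hbot : ⨅ n, H n = ⊥) {γ : Γ}
    (hγ : γ ≠ 1) : γ • y₀ ≠ y₀ := fun he => by
  obtain ⟨n, hn⟩ := h.exists_smul_base_ne hbot hγ
  exact hn (by rw [he])

/-- For `γ ≠ 1` the set of points moved by `γ` is open and contains the dense orbit of `y₀`, since
`y₀` and hence every point of its orbit has trivial stabilizer. Countability of Γ allows
intersecting over `γ`. -/
theorem isTopologicallyFree [Countable Γ] [T2Space Y] (h : IsCosetTower H Y π y₀)
    (hbot : ⨅ n, H n = ⊥) : IsTopologicallyFree Γ Y := by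
  have := h.continuousConstSMul
  have hmin := h.isMinimal
  have key : ∀ γ : Γ, γ ≠ 1 → {y : Y | γ • y ≠ y} ∈ residual Y := by
    intro γ hγ
    refine residual_of_dense_open ?_ ?_
    · exact isOpen_ne_fun (continuous_const_smul γ) continuous_id
    · refine (hmin.dense_orbit y₀).mono ?_
      rintro _ ⟨δ, rfl⟩ he
      refine h.smul_base_ne hbot (γ := δ⁻¹ * γ * δ) (fun h1 => hγ ?_) ?_
      · rw [mul_assoc, inv_mul_eq_one] at h1
        simpa using h1.symm
      · rw [mul_smul, mul_smul, inv_smul_eq_iff]; exact he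
  have hall : ∀ᶠ y in residual Y, ∀ γ : Γ, γ ≠ 1 → γ • y ≠ y := by
    rw [eventually_countable_forall]
    intro γ
    by_cases hγ : γ = 1
    · simp [hγ]
    · filter_upwards [key γ hγ] with y hy _ using hy
  refine Filter.mem_of_superset hall fun y hy => ?_
  refine (Subgroup.eq_bot_iff_forall _).2 fun γ hγ => ?_
  by_contra hne
  exact hy γ hne hγ

theorem nontrivial_of_isOpen (h : IsCosetTower H Y π y₀) (hbot : ⨅ n, H n = ⊥) [Infinite Γ]
    [∀ n, (H n).FiniteIndex] (V : Set Y) (hV : IsOpen V) (hne : V.Nonempty) : V.Nontrivial := by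
  obtain ⟨x, hx⟩ := hne
  obtain ⟨n, hn⟩ := h.exists_fiber_subset V hV x hx
  obtain ⟨γ, hγ⟩ := QuotientGroup.mk_surjective (π n x)
  -- A finite-index subgroup of an infinite group is nontrivial; `γ • y₀` and `γ • δ • y₀` then lie
  -- in the same fibre.
  obtain ⟨δ, hδ, hδ1⟩ : ∃ δ ∈ H n, δ ≠ 1 := by
    by_contra! hc
    have hb : H n = ⊥ := (Subgroup.eq_bot_iff_forall _).2 hc
    have hfin : (⊥ : Subgroup Γ).FiniteIndex := hb ▸ inferInstance
    exact hfin.index_ne_zero (by rw [Subgroup.index_bot, Nat.card_eq_zero_of_infinite])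
  refine ⟨γ • y₀, hn ?_, γ • δ • y₀, hn ?_, fun he => h.smul_base_ne hbot hδ1 ?_⟩
  · simp [h.map_smul_base, hγ]
  · rw [← mul_smul, Set.mem_preimage, h.map_smul_base, Set.mem_singleton_iff, ← hγ,
      QuotientGroup.eq]
    simpa using hδ
  · exact (MulAction.injective γ he).symm

/-- Compactness bounds the level needed to describe `U`. Having all `m ≥ n` lets finitely many
clopen sets share one level. -/
theorem exists_preimage_of_isClopen [CompactSpace Y] (h : IsCosetTower H Y π y₀) {U : Set Y}
    (hU : IsClopen U) : ∃ n, ∀ m ≥ n, ∃ W : Set (Γ ⧸ H m), U = π m ⁻¹' W := by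
  have hmono : Monotone fun n => {x | π n ⁻¹' {π n x} ⊆ U} := fun m n hmn x hx y hy =>
    hx (h.eq_of_le m n hmn y x hy)
  obtain ⟨n, hn⟩ := hU.isClosed.isCompact.elim_directed_cover
    (fun n => {x | π n ⁻¹' {π n x} ⊆ U}) (fun n => h.isOpen_preimage n {q | π n ⁻¹' {q} ⊆ U})
    (fun x hx => Set.mem_iUnion.2 (h.exists_fiber_subset U hU.isOpen x hx)) hmono.directed_le
  refine ⟨n, fun m hm => ⟨π m '' U, Set.Subset.antisymm (Set.subset_preimage_image _ _) ?_⟩⟩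
  rintro y ⟨x, hx, hxy⟩
  exact hmono hm (hn hx) hxy.symm

theorem smul_preimage (h : IsCosetTower H Y π y₀) (n : ℕ) (γ : Γ) (W : Set (Γ ⧸ H n)) :
    γ • π n ⁻¹' W = π n ⁻¹' (γ • W) := by
  ext y
  simp [Set.mem_smul_set_iff_inv_smul_mem, h.map_smul]

theorem isProfiniteAction [CompactSpace Y] [∀ n, (H n).FiniteIndex]
    (h : IsCosetTower H Y π y₀) : IsProfiniteAction Γ Y := by
  intro U hU
  obtain ⟨n, hn⟩ := h.exists_preimage_of_isClopen hU
  obtain ⟨W, rfl⟩ := hn n le_rfl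
  refine (Set.finite_range fun W : Set (Γ ⧸ H n) => π n ⁻¹' W).subset ?_
  rintro _ ⟨γ, rfl⟩
  exact ⟨γ • W, (h.smul_preimage n γ W).symm⟩

end IsCosetTower

/-! ### Almost finiteness bounds fixed points. -/

theorem card_filter_notMem_le_ncard_symmDiff [DecidableEq Γ] (g : Γ) (S : Finset Γ) :
    (S.filter fun s => g * s ∉ S).card ≤
      (symmDiff ((({g} : Finset Γ) : Set Γ) * (S : Set Γ)) (S : Set Γ)).ncard := by
  rw [← Finset.coe_mul, ← Finset.coe_symmDiff, Set.ncard_coe_finset]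
  refine Finset.card_le_card_of_injOn (g * ·) (fun s hs => ?_) (mul_right_injective g).injOn
  simp only [Finset.coe_filter, Set.mem_ofPred_eq] at hs
  simp only [SetLike.mem_coe, Finset.mem_symmDiff]
  exact Or.inl ⟨Finset.mul_mem_mul (Finset.mem_singleton_self g) hs.1, hs.2⟩

/-- If a finite `Γ`-set is partitioned into towers whose shapes are nearly invariant under `g ≠ 1`,
then `g` has few fixed points. -/
theorem card_fixed_le_of_towers {Q : Type*} [MulAction Γ Q] [Finite Q] {g : Γ} (hg : g ≠ 1)
    {ε : ℝ} {k : ℕ} (W : Fin k → Set Q) (S : Fin k → Finset Γ)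
    (hdisj : Pairwise fun p q : Σ i : Fin k, {s : Γ // s ∈ S i} =>
      Disjoint ((p.2 : Γ) • W p.1) ((q.2 : Γ) • W q.1))
    (hS : ∀ i, ((symmDiff ((({g} : Finset Γ) : Set Γ) * (S i : Set Γ)) (S i : Set Γ)).ncard : ℝ)
        < ε * ((S i).card : ℝ))
    (hcov : ∀ q, ∃ i, ∃ s ∈ S i, q ∈ s • W i) :
    ({q : Q | g • q = q}.ncard : ℝ) ≤ ε * Nat.card Q := by
  classical
  have hcard : Nat.card Q = ∑ i, (S i).card * (W i).ncard := by
    have h1 : (Set.univ : Set Q) = ⋃ p : Σ i : Fin k, {s : Γ // s ∈ S i}, (p.2 : Γ) • W p.1 := by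
      refine (Set.eq_univ_of_forall fun q => ?_).symm
      obtain ⟨i, s, hs, hq⟩ := hcov q
      exact Set.mem_iUnion.2 ⟨⟨i, s, hs⟩, hq⟩
    rw [← Set.ncard_univ, h1, Set.ncard_iUnion_of_finite (fun _ => Set.toFinite _) hdisj,
      finsum_eq_sum_of_fintype, Fintype.sum_sigma]
    refine Finset.sum_congr rfl fun i _ => ?_
    simp [Set.ncard_smul_set]
  have hfix : {q : Q | g • q = q} ⊆
      ⋃ i ∈ (Finset.univ : Finset (Fin k)), ⋃ s ∈ (S i).filter fun s => g * s ∉ S i, s • W i := by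
    intro q hq
    obtain ⟨i, s, hs, hqs⟩ := hcov q
    simp only [Set.mem_iUnion, Finset.mem_filter, Finset.mem_univ]
    refine ⟨i, trivial, s, ⟨hs, fun hgs => ?_⟩, hqs⟩
    -- If `g * s` were in the shape, `q = g • q` would lie in two distinct, hence disjoint, levels.
    have hne : (⟨i, s, hs⟩ : Σ i : Fin k, {s : Γ // s ∈ S i}) ≠ ⟨i, g * s, hgs⟩ := by
      intro he
      simp only [Sigma.mk.injEq, heq_eq_eq, Subtype.mk.injEq, true_and] at he
      exact hg (by simpa using he)
    refine Set.disjoint_left.1 (hdisj hne) hqs ?_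
    change q ∈ (g * s) • W i
    rw [mul_smul, ← (show g • q = q from hq)]
    exact Set.smul_mem_smul_set hqs
  have hle : {q : Q | g • q = q}.ncard ≤
      ∑ i, ((S i).filter fun s => g * s ∉ S i).card * (W i).ncard := by
    refine (Set.ncard_le_ncard hfix (Set.toFinite _)).trans
      ((Finset.set_ncard_biUnion_le _ _).trans (Finset.sum_le_sum fun i _ => ?_))
    refine (Finset.set_ncard_biUnion_le _ _).trans ?_
    simp [Set.ncard_smul_set]
  calc ({q : Q | g • q = q}.ncard : ℝ)
      ≤ ∑ i, (((S i).filter fun s => g * s ∉ S i).card : ℝ) * (W i).ncard := by exact_mod_cast hle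
    _ ≤ ∑ i, ε * (S i).card * (W i).ncard := by
      refine Finset.sum_le_sum fun i _ => mul_le_mul_of_nonneg_right ?_ (Nat.cast_nonneg _)
      refine le_trans ?_ (hS i).le
      exact_mod_cast card_filter_notMem_le_ncard_symmDiff g (S i)
    _ = ε * Nat.card Q := by
      rw [hcard]; push_cast; rw [Finset.mul_sum]
      exact Finset.sum_congr rfl fun i _ => by ring

theorem IsCosetTower.not_isAlmostFinite {H : ℕ → Subgroup Γ} {Y : Type*} [TopologicalSpace Y]
    [MulAction Γ Y] {π : ∀ n, Y → Γ ⧸ H n} {y₀ : Y} [CompactSpace Y] [∀ n, (H n).FiniteIndex]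
    (h : IsCosetTower H Y π y₀) {g : Γ} (hg : g ≠ 1)
    (hfix : ∀ n, ((H n).index : ℝ) / 2 ≤ ({q : Γ ⧸ H n | g • q = q}.ncard : ℝ)) :
    ¬ IsAlmostFinite Γ Y := by
  intro haf
  -- Any `ε < 1 / 2` contradicts `hfix`.
  obtain ⟨k, V, S, hV, hdisj, hS, hcov⟩ :=
    haf {g} (Finset.singleton_nonempty g) (1 / 4) (by norm_num)
  choose N hN using fun i => h.exists_preimage_of_isClopen (hV i)
  set n := Finset.univ.sup N with hn
  choose W hW using fun i => hN i n (Finset.le_sup (Finset.mem_univ i))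
  have hsV : ∀ i (s : Γ), s • V i = π n ⁻¹' (s • W i) := fun i s => by
    rw [hW i, h.smul_preimage]
  have := card_fixed_le_of_towers (Q := Γ ⧸ H n) hg W S (fun p q hpq => ?_) hS (fun q => ?_)
  · have h2 := hfix n
    have h3 : (0 : ℝ) < (H n).index := by
      exact_mod_cast Nat.pos_of_ne_zero Subgroup.FiniteIndex.index_ne_zero
    rw [← Subgroup.index_eq_card] at this
    linarith
  · have := hdisj hpq
    simp only [hsV] at this
    exact this.of_preimage (h.surjective n)
  · obtain ⟨y, rfl⟩ := h.surjective n q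
    have hy : y ∈ ⋃ i, ⋃ s ∈ S i, s • V i := hcov ▸ Set.mem_univ y
    simp only [Set.mem_iUnion, hsV] at hy
    obtain ⟨i, s, hs, hy⟩ := hy
    exact ⟨i, s, hs, hy⟩

theorem CosetLimit.isCosetTower (hH : Antitone H) :
    IsCosetTower H (CosetLimit H) (fun n x => x.coord n)
      ⟨fun _ => ((1 : Γ) : Γ ⧸ _), fun _ _ _ => ⟨1, rfl, rfl⟩⟩ where
  map_smul _ _ _ := rfl
  isOpen_fiber := isOpen_cylinder H
  exists_fiber_subset _ hU _ hy := exists_cylinder_subset H hH hU hy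
  eq_of_le _ _ hmn _ _ h := CosetLimit.eq_of_le H hH hmn h
  map_base _ := rfl

/-- The inverse limit of a sequence of finite-index subgroups with trivial intersection is a
Cantor space. -/
theorem CosetLimit.nonempty_homeomorph_cantor (hH : Antitone H) [Countable Γ] [Infinite Γ]
    [∀ n, (H n).FiniteIndex] (hbot : ⨅ n, H n = ⊥) :
    Nonempty (CosetLimit H ≃ₜ (ℕ → Bool)) := by
  have hT := CosetLimit.isCosetTower H hH
  have := CosetLimit.compactSpace H
  have : Nonempty (Σ n, Γ ⧸ H n) := ⟨⟨0, ((1 : Γ) : Γ ⧸ H 0)⟩⟩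
  obtain ⟨f, hf⟩ := exists_surjective_nat (Σ n, Γ ⧸ H n)
  refine _root_.nonempty_homeomorph_cantor (fun j => {x : CosetLimit H | x.coord (f j).1 = (f j).2})
    (fun j => ⟨⟨?_⟩, isOpen_cylinder H _ _⟩) (fun x y hxy => ?_) (hT.nontrivial_of_isOpen hbot)
  · exact hT.isOpen_preimage (f j).1 {(f j).2}ᶜ
  · refine CosetLimit.ext (funext fun n => ?_)
    obtain ⟨j, hj⟩ := hf ⟨n, x.coord n⟩
    have := hxy j
    rw [hj] at this
    exact (this.1 rfl).symm

/-- Transport of a coset tower along a homeomorphism. -/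
theorem IsCosetTower.congr {H : ℕ → Subgroup Γ} {X Y : Type*} [TopologicalSpace X]
    [MulAction Γ X] [TopologicalSpace Y] [MulAction Γ Y] {π : ∀ n, X → Γ ⧸ H n} {x₀ : X}
    (h : IsCosetTower H X π x₀) (e : Y ≃ₜ X) (he : ∀ (γ : Γ) y, e (γ • y) = γ • e y) :
    IsCosetTower H Y (fun n y => π n (e y)) (e.symm x₀) where
  map_smul n γ y := by rw [he, h.map_smul]
  isOpen_fiber n q := (h.isOpen_fiber n q).preimage e.continuous
  exists_fiber_subset U hU y hy := by
    obtain ⟨n, hn⟩ := h.exists_fiber_subset (e.symm ⁻¹' U) (hU.preimage e.symm.continuous) (e y)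
      (by simpa using hy)
    exact ⟨n, fun z hz => by simpa using hn (show e z ∈ π n ⁻¹' {π n (e y)} from hz)⟩
  eq_of_le m n hmn x y hxy := h.eq_of_le m n hmn _ _ hxy
  map_base n := by simp [h.map_base]

theorem exists_action_cantor_not_isAlmostFinite [Countable Γ] [Infinite Γ] (hH : Antitone H)
    [∀ n, (H n).FiniteIndex] (hbot : ⨅ n, H n = ⊥) {g : Γ} (hg : g ≠ 1)
    (hfix : ∀ n, ((H n).index : ℝ) / 2 ≤ ({q : Γ ⧸ H n | g • q = q}.ncard : ℝ)) :
    ∃ _ : MulAction Γ (ℕ → Bool), ContinuousConstSMul Γ (ℕ → Bool) ∧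
      MulAction.IsMinimal Γ (ℕ → Bool) ∧ IsTopologicallyFree Γ (ℕ → Bool) ∧
      IsProfiniteAction Γ (ℕ → Bool) ∧ ¬ IsAlmostFinite Γ (ℕ → Bool) := by
  obtain ⟨e⟩ := CosetLimit.nonempty_homeomorph_cantor H hH hbot
  let _ : MulAction Γ (ℕ → Bool) := e.symm.toEquiv.mulAction Γ
  have hT := (CosetLimit.isCosetTower H hH).congr e.symm fun γ y => e.symm_apply_apply _
  exact ⟨inferInstance, hT.continuousConstSMul, hT.isMinimal, hT.isTopologicallyFree hbot,
    hT.isProfiniteAction, hT.not_isAlmostFinite hg hfix⟩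

end Tower

/-! ### Residual finiteness of finitely generated nilpotent groups. -/

-- By induction on the class it suffices that the center of the quotient by the center is torsion.
-- If `z` is central modulo the center, each commutator of `z` with `s` is central, hence torsion,
-- so a power of `z` commutes with `s`. Multiplying the exponents over a finite generating set makes
-- a power of `z` central.
open Subgroup in
theorem Group.isMulTorsion_of_isMulTorsion_center (G : Type*) [Group G] [Group.IsNilpotent G]
    (hfg : Group.FG G) (hZ : ∀ z ∈ center G, IsOfFinOrder z) : ∀ x : G, IsOfFinOrder x := by
  revert hfg hZ
  refine Group.nilpotent_center_quotient_ind (P := fun G [Group G] [Group.IsNilpotent G] =>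
    Group.FG G → (∀ z ∈ center G, IsOfFinOrder z) → ∀ x : G, IsOfFinOrder x) G ?_ ?_
  · intro G _ _ _ _ x
    rw [Subsingleton.elim x 1]
    exact IsOfFinOrder.one
  · intro G _ _ ih hfg hZ x
    have hpow : ∀ y : G, IsOfFinOrder (y : G ⧸ center G) → IsOfFinOrder y := by
      intro y hy
      obtain ⟨n, hn, h⟩ := isOfFinOrder_iff_pow_eq_one.1 hy
      rw [← QuotientGroup.mk_pow, QuotientGroup.eq_one_iff] at h
      obtain ⟨m, hm, h'⟩ := isOfFinOrder_iff_pow_eq_one.1 (hZ _ h)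
      exact isOfFinOrder_iff_pow_eq_one.2 ⟨n * m, by positivity, by rw [pow_mul, h']⟩
    refine hpow x (ih inferInstance (fun z hz => ?_) x)
    obtain ⟨z, rfl⟩ := QuotientGroup.mk_surjective z
    have hcomm : ∀ s : G, ∃ k : ℕ, 0 < k ∧ Commute (z ^ k) s := by
      intro s
      have h1 : z * s * z⁻¹ * s⁻¹ ∈ center G := by
        rw [← QuotientGroup.eq_one_iff]
        have := mem_center_iff.1 hz s
        simp only [QuotientGroup.mk_mul, QuotientGroup.mk_inv]
        rw [← this]; group
      obtain ⟨k, hk, h⟩ := isOfFinOrder_iff_pow_eq_one.1 (hZ _ h1)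
      refine ⟨k, hk, ?_⟩
      have key : ∀ j : ℕ, z ^ j * s = (z * s * z⁻¹ * s⁻¹) ^ j * s * z ^ j := by
        intro j
        induction j with
        | zero => simp
        | succ j ihj =>
          have hc := mem_center_iff.1 (pow_mem h1 j) z
          calc z ^ (j + 1) * s = z * (z ^ j * s) := by rw [pow_succ', mul_assoc]
            _ = (z * (z * s * z⁻¹ * s⁻¹) ^ j) * s * z ^ j := by rw [ihj]; group
            _ = (z * s * z⁻¹ * s⁻¹) ^ (j + 1) * s * z ^ (j + 1) := by
              rw [hc, pow_succ (z * s * z⁻¹ * s⁻¹), pow_succ' z]; group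
      have := key k
      rwa [h, one_mul] at this
    choose k hk hkc using hcomm
    obtain ⟨S, hS⟩ := hfg.1
    refine isOfFinOrder_iff_pow_eq_one.2 ⟨∏ s ∈ S, k s, Finset.prod_pos fun s _ => hk s, ?_⟩
    rw [← QuotientGroup.mk_pow, QuotientGroup.eq_one_iff, mem_center_iff]
    have hle : closure (S : Set G) ≤ centralizer {z ^ ∏ s ∈ S, k s} := by
      rw [closure_le]
      intro s hs
      obtain ⟨r, hr⟩ := Finset.dvd_prod_of_mem k hs
      rw [SetLike.mem_coe, mem_centralizer_singleton_iff, hr, pow_mul]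
      exact ((hkc s).pow_left r).eq.symm
    intro g
    have := hle (hS ▸ mem_top g)
    exact mem_centralizer_singleton_iff.1 this

-- By induction the quotient by the center is finite, so the center is finitely generated, abelian
-- and torsion, hence finite.
open Subgroup in
theorem Group.finite_of_fg_of_isNilpotent_of_isMulTorsion (G : Type*) [Group G]
    [Group.IsNilpotent G] (hfg : Group.FG G) (hG : ∀ x : G, IsOfFinOrder x) : Finite G := by
  revert hfg hG
  refine Group.nilpotent_center_quotient_ind (P := fun G [Group G] [Group.IsNilpotent G] =>
    Group.FG G → (∀ x : G, IsOfFinOrder x) → Finite G) G ?_ ?_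
  · intro G _ _ _ _
    infer_instance
  · intro G _ _ ih hfg hG
    have h1 : Finite (G ⧸ center G) := ih inferInstance fun x => by
      obtain ⟨x, rfl⟩ := QuotientGroup.mk_surjective x
      exact MonoidHom.isOfFinOrder (QuotientGroup.mk' (center G)) (hG x)
    have h2 : (center G).FiniteIndex := Subgroup.finiteIndex_of_finite_quotient
    let _ : CommGroup (center G) :=
      { mul_comm := fun a b => Subtype.ext (mem_center_iff.1 b.2 a) }
    have h3 : Finite (center G) := CommGroup.finite_of_fg_isMulTorsion (center G) fun x =>
      Submonoid.isOfFinOrder_coe.1 (hG x)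
    exact Finite.of_equiv _ (Subgroup.groupEquivQuotientProdSubgroup (s := center G)).symm

/-- A nilpotent finitely generated group in which `g ≠ 1` lies in every nontrivial normal subgroup
is finite. -/
theorem Group.finite_of_monolithic (G : Type*) [Group G] [Group.IsNilpotent G]
    (hfg : Group.FG G) (g : G) (hg : g ≠ 1)
    (hmono : ∀ N : Subgroup G, N.Normal → N ≠ ⊥ → g ∈ N) : Finite G := by
  refine finite_of_fg_of_isNilpotent_of_isMulTorsion G hfg
    (isMulTorsion_of_isMulTorsion_center G hfg fun z hz => ?_)
  by_contra hz'
  have hmem : ∀ w ∈ Subgroup.center G, w ≠ 1 → g ∈ Subgroup.zpowers w := by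
    intro w hw hw1
    refine hmono _ ⟨fun n hn x => ?_⟩ (by simpa using hw1)
    have : n ∈ Subgroup.center G := (Subgroup.zpowers_le.2 hw) hn
    rw [Subgroup.mem_center_iff.1 this x]
    simpa using hn
  have hinj := injective_zpow_iff_not_isOfFinOrder.2 hz'
  obtain ⟨m, hm⟩ := Subgroup.mem_zpowers_iff.1 (hmem z hz fun h => hz' (h ▸ IsOfFinOrder.one))
  have hm0 : m ≠ 0 := fun h => hg (by rw [← hm, h, zpow_zero])
  -- With `g = z ^ m` of infinite order, `g` is not a power of `z ^ (2 * m)`: `2 * m * k = m` has no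
  -- solution with `m ≠ 0`.
  obtain ⟨k, hk⟩ := Subgroup.mem_zpowers_iff.1 (hmem (z ^ (2 * m)) (Subgroup.zpow_mem _ hz _)
    fun h => by
      have : (2 * m) = 0 := hinj (by simpa using h)
      omega)
  have h2 : 2 * m * k = m := hinj (by simp only [zpow_mul, hm] at hk ⊢; exact hk)
  have h3 : m * (2 * k - 1) = 0 := by linarith
  rcases mul_eq_zero.1 h3 with h | h <;> omega

/-- In the quotient by a normal subgroup maximal among those avoiding `g`, every nontrivial normal
subgroup contains the image of `g`, so `Group.finite_of_monolithic` applies. -/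
theorem Group.exists_normal_finiteIndex_notMem (G : Type*) [Group G] [Group.IsNilpotent G]
    (hfg : Group.FG G) (g : G) (hg : g ≠ 1) :
    ∃ N : Subgroup G, N.Normal ∧ N.FiniteIndex ∧ g ∉ N := by
  obtain ⟨N, -, hN⟩ := zorn_le_nonempty₀ {N : Subgroup G | N.Normal ∧ g ∉ N} (by
    intro c hc hchain M hM
    have hne : Nonempty c := ⟨⟨M, hM⟩⟩
    have hdir : Directed (· ≤ ·) ((↑) : c → Subgroup G) := hchain.directed
    refine ⟨⨆ N : c, (N : Subgroup G), ⟨⟨fun n hn x => ?_⟩, fun h => ?_⟩, fun N hN =>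
      le_iSup ((↑) : c → Subgroup G) ⟨N, hN⟩⟩
    · obtain ⟨i, hi⟩ := (Subgroup.mem_iSup_of_directed hdir).1 hn
      exact (Subgroup.mem_iSup_of_directed hdir).2 ⟨i, (hc i.2).1.conj_mem n hi x⟩
    · obtain ⟨i, hi⟩ := (Subgroup.mem_iSup_of_directed hdir).1 h
      exact (hc i.2).2 hi) ⊥ ⟨inferInstance, by simpa using hg⟩
  have hNn : N.Normal := hN.prop.1
  refine ⟨N, hNn, ?_, hN.prop.2⟩
  have : Finite (G ⧸ N) := by
    refine finite_of_monolithic (G ⧸ N) inferInstance (g : G ⧸ N)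
      (by rw [Ne, QuotientGroup.eq_one_iff]; exact hN.prop.2) fun M hM hMb => ?_
    by_contra hgM
    have hle : N ≤ M.comap (QuotientGroup.mk' N) := fun x hx => by
      rw [Subgroup.mem_comap, QuotientGroup.mk'_apply, (QuotientGroup.eq_one_iff x).2 hx]
      exact M.one_mem
    have hmax := hN.le_of_ge (y := M.comap (QuotientGroup.mk' N)) ⟨hM.comap _, hgM⟩ hle
    refine hMb ((Subgroup.eq_bot_iff_forall _).2 fun x hx => ?_)
    obtain ⟨x, rfl⟩ := QuotientGroup.mk_surjective x
    exact (QuotientGroup.eq_one_iff x).2 (hmax hx)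
  exact Subgroup.finiteIndex_of_finite_quotient

theorem Group.countable_of_fg {G : Type*} [Group G] (h : Group.FG G) : Countable G := by
  obtain ⟨S, hS, f, hf⟩ := Group.fg_iff_exists_freeGroup_hom_surjective.1 h
  have := hS.to_subtype
  exact hf.countable

/-- A countable infinite residually finite group has a sequence of normal subgroups of
finite index, of growth as fast as desired, eventually avoiding each nontrivial element. -/
theorem exists_antitone_normal_finiteIndex (Λ : Type*) [Group Λ] [Countable Λ] [Infinite Λ]
    (hres : ∀ g : Λ, g ≠ 1 → ∃ N : Subgroup Λ, N.Normal ∧ N.FiniteIndex ∧ g ∉ N) (b : ℕ → ℕ) :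
    ∃ L : ℕ → Subgroup Λ, (∀ n, (L n).Normal) ∧ (∀ n, (L n).FiniteIndex) ∧
      (∀ g, g ≠ 1 → ∀ᶠ n in Filter.atTop, g ∉ L n) ∧ ∀ n, b n ≤ (L n).index := by
  have hres' : ∀ g : Λ, ∃ N : Subgroup Λ, N.Normal ∧ N.FiniteIndex ∧ (g ≠ 1 → g ∉ N) := by
    intro g
    by_cases hg : g = 1
    · exact ⟨⊤, inferInstance, inferInstance, fun h => absurd hg h⟩
    · obtain ⟨N, h1, h2, h3⟩ := hres g hg
      exact ⟨N, h1, h2, fun _ => h3⟩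
  choose N hN hNf hNg using hres'
  obtain ⟨f, hf⟩ := exists_surjective_nat Λ
  let M : ℕ → Subgroup Λ := fun n => ⨅ i ∈ Finset.range n, N (f i)
  have hMmem : ∀ {n g}, g ∈ M n ↔ ∀ i < n, g ∈ N (f i) := by
    intro n g; simp [M, Subgroup.mem_iInf]
  have hMnorm : ∀ n, (M n).Normal := fun n =>
    ⟨fun x hx g => hMmem.2 fun i hi => (hN (f i)).conj_mem x (hMmem.1 hx i hi) g⟩
  have hMfin : ∀ n, (M n).FiniteIndex := fun n =>
    Subgroup.finiteIndex_iInf' (s := Finset.range n) _ fun i _ => hNf (f i)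
  have hMsep : ∀ g, g ≠ 1 → ∀ᶠ n in Filter.atTop, g ∉ M n := by
    intro g hg
    obtain ⟨i, rfl⟩ := hf g
    filter_upwards [Filter.eventually_gt_atTop i] with n hn h
    exact hNg _ hg (hMmem.1 h i hn)
  -- A set of `b` elements eventually injects into `Λ ⧸ M n`, as `M n` avoids the finitely many
  -- nontrivial quotients `x⁻¹ * y`.
  have hMind : ∀ b : ℕ, ∀ᶠ n in Filter.atTop, b ≤ (M n).index := by
    intro b
    obtain ⟨F, hF⟩ := Infinite.exists_subset_card_eq Λ b
    have : ∀ᶠ n in Filter.atTop, ∀ x ∈ F, ∀ y ∈ F, x ≠ y → x⁻¹ * y ∉ M n := by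
      rw [Filter.eventually_all_finset]
      intro x _
      rw [Filter.eventually_all_finset]
      intro y _
      by_cases hxy : x = y
      · simp [hxy]
      · filter_upwards [hMsep (x⁻¹ * y) (by rwa [Ne, inv_mul_eq_one])] with n hn _ using hn
    filter_upwards [this] with n hn
    have hfin := hMfin n
    rw [Subgroup.index_eq_card, ← hF, ← Nat.card_eq_finsetCard]
    refine Nat.card_le_card_of_injective (fun x : F => ((x : Λ) : Λ ⧸ M n)) fun x y hxy => ?_
    by_contra hne
    exact hn x x.2 y y.2 (fun h => hne (Subtype.ext h)) (QuotientGroup.eq.1 hxy)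
  obtain ⟨φ, hφ, hφb⟩ := Filter.extraction_forall_of_eventually fun n => hMind (b n)
  exact ⟨fun n => M (φ n), fun n => hMnorm _,
    fun n => hMfin _, fun g hg => hφ.tendsto_atTop.eventually (hMsep g hg), hφb⟩

theorem Subgroup.ncard_fiber_mul_index {G : Type*} [Group G] {H P : Subgroup G} (h : H ≤ P)
    (p : G ⧸ P) : {q : G ⧸ H | Subgroup.quotientMapOfLE h q = p}.ncard * P.index = H.index := by
  rw [← Subgroup.relIndex_mul_index h]
  congr 1
  let e := Subgroup.quotientEquivProdOfLE h
  have he : ∀ q, (e q).1 = Subgroup.quotientMapOfLE h q := fun q => rfl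
  have : {q : G ⧸ H | Subgroup.quotientMapOfLE h q = p} = e ⁻¹' ({p} ×ˢ Set.univ) := by
    ext q; simp [← he]
  rw [this, ← Nat.card_coe_set_eq, Nat.card_preimage_of_injective e.injective (by simp),
    Nat.card_coe_set_eq, Set.ncard_prod, Set.ncard_singleton, one_mul, Set.ncard_univ]
  rfl

/-! ### Subgroups of the wreath product cut out by a coset sum. -/

section CosetSum

variable {A Λ : Type*} [AddCommGroup A] [Group Λ]

open Classical in
/-- The sum of the values of a finitely supported function over the coset `c L`. -/
noncomputable def cosetSum (L : Subgroup Λ) (c : Λ) : (Λ →₀ A) →+ A :=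
  Finsupp.liftAddHom fun x => if c⁻¹ * x ∈ L then AddMonoidHom.id A else 0

open Classical in
theorem cosetSum_single (L : Subgroup Λ) (c x : Λ) (a : A) :
    cosetSum L c (Finsupp.single x a) = if c⁻¹ * x ∈ L then a else 0 := by
  rw [cosetSum, Finsupp.liftAddHom_apply_single]
  split_ifs <;> rfl

theorem cosetSum_eq_apply (L : Subgroup Λ) (c : Λ) (f : Λ →₀ A)
    (h : ∀ x ∈ f.support, x ≠ c → c⁻¹ * x ∉ L) : cosetSum L c f = f c := by
  classical
  rw [cosetSum, Finsupp.liftAddHom_apply, Finsupp.sum, Finset.sum_eq_single c]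
  · simp
  · intro x hx hxc
    simp [h x hx hxc]
  · intro hc
    simp [Finsupp.notMem_support_iff.1 hc]

theorem wreathShift_single (γ x : Λ) (a : A) :
    wreathShift A Λ γ (Multiplicative.ofAdd (Finsupp.single x a)) =
      Multiplicative.ofAdd (Finsupp.single (γ * x) a) := by
  refine Multiplicative.toAdd.injective (Finsupp.ext fun y => ?_)
  classical
  rw [wreathShift_apply, toAdd_ofAdd, toAdd_ofAdd, Finsupp.single_apply, Finsupp.single_apply]
  simp only [eq_inv_mul_iff_mul_eq]

/-- Normality gives `c L = L c`, so left translation by `γ ∈ L` preserves the coset. -/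
theorem cosetSum_wreathShift (L : Subgroup Λ) [hL : L.Normal] (c : Λ) {γ : Λ} (hγ : γ ∈ L)
    (f : Λ →₀ A) :
    cosetSum L c (wreathShift A Λ γ (Multiplicative.ofAdd f)).toAdd = cosetSum L c f := by
  induction f using Finsupp.induction_linear with
  | zero => simp
  | add f g hf hg => rw [ofAdd_add, map_mul, toAdd_mul, map_add, map_add, hf, hg]
  | single x a =>
    rw [wreathShift_single, toAdd_ofAdd, cosetSum_single, cosetSum_single]
    have : c⁻¹ * (γ * x) ∈ L ↔ c⁻¹ * x ∈ L := by
      have h1 : c⁻¹ * γ * c ∈ L := by simpa using hL.conj_mem γ hγ c⁻¹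
      have h2 : c⁻¹ * γ * c * (c⁻¹ * x) ∈ L ↔ c⁻¹ * x ∈ L := mul_mem_cancel_left h1
      simpa [mul_assoc] using h2
    classical exact if_congr this rfl rfl

/-- The elements `(f, γ)` with `γ ∈ L` such that the sum of `f` over the coset `c L` is in `B`. -/
noncomputable def cosetSumSubgroup (L : Subgroup Λ) [L.Normal] (c : Λ) (B : AddSubgroup A) :
    Subgroup (WreathProduct A Λ) where
  carrier := {a | a.right ∈ L ∧ cosetSum L c a.left.toAdd ∈ B}
  one_mem' := by simp [L.one_mem, B.zero_mem]
  mul_mem' := by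
    rintro a b ⟨ha, ha'⟩ ⟨hb, hb'⟩
    refine ⟨L.mul_mem ha hb, ?_⟩
    rw [SemidirectProduct.mul_left, toAdd_mul, map_add]
    exact B.add_mem ha' ((cosetSum_wreathShift L c ha b.left.toAdd).symm ▸ hb')
  inv_mem' := by
    rintro a ⟨ha, ha'⟩
    refine ⟨L.inv_mem ha, ?_⟩
    rw [SemidirectProduct.inv_left]
    have := cosetSum_wreathShift L c (L.inv_mem ha) (a.left⁻¹).toAdd
    rw [ofAdd_toAdd] at this
    rw [this, toAdd_inv, map_neg]
    exact B.neg_mem ha'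

theorem mem_cosetSumSubgroup {L : Subgroup Λ} [L.Normal] {c : Λ} {B : AddSubgroup A}
    {a : WreathProduct A Λ} :
    a ∈ cosetSumSubgroup L c B ↔ a.right ∈ L ∧ cosetSum L c a.left.toAdd ∈ B := Iff.rfl

theorem cosetSumSubgroup_le (L : Subgroup Λ) [L.Normal] (c : Λ) (B : AddSubgroup A) :
    cosetSumSubgroup L c B ≤ L.comap SemidirectProduct.rightHom := fun _ h => h.1

theorem index_comap_rightHom (L : Subgroup Λ) :
    (L.comap (SemidirectProduct.rightHom (φ := wreathShift A Λ))).index = L.index :=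
  L.index_comap_of_surjective SemidirectProduct.rightHom_surjective

/-- On the preimage of `L`, by shift invariance, the coset sum modulo `B` is a homomorphism to the
finite group `A ⧸ B`; its kernel is the subgroup in question. -/
theorem finiteIndex_cosetSumSubgroup (L : Subgroup Λ) [L.Normal] [L.FiniteIndex] (c : Λ)
    (B : AddSubgroup A) [B.FiniteIndex] : (cosetSumSubgroup L c B).FiniteIndex := by
  let P := L.comap (SemidirectProduct.rightHom (φ := wreathShift A Λ))
  let ψ : P →* Multiplicative (A ⧸ B) :=
    { toFun := fun a => Multiplicative.ofAdd ((cosetSum L c a.1.left.toAdd : A) : A ⧸ B)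
      map_one' := by simp
      map_mul' := fun a b => by
        rw [Subgroup.coe_mul, SemidirectProduct.mul_left, toAdd_mul, map_add,
          QuotientAddGroup.mk_add, ofAdd_add]
        congr 3
        exact cosetSum_wreathShift L c a.2 b.1.left.toAdd }
  have hker : (cosetSumSubgroup L c B).subgroupOf P = ψ.ker := by
    ext a
    rw [Subgroup.mem_subgroupOf, mem_cosetSumSubgroup, MonoidHom.mem_ker]
    change _ ↔ Multiplicative.ofAdd ((cosetSum L c a.1.left.toAdd : A) : A ⧸ B) = 1
    rw [ofAdd_eq_one, QuotientAddGroup.eq_zero_iff]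
    exact and_iff_right a.2
  refine ⟨?_⟩
  rw [← Subgroup.relIndex_mul_index (cosetSumSubgroup_le L c B), index_comap_rightHom]
  refine mul_ne_zero ?_ Subgroup.FiniteIndex.index_ne_zero
  have : Finite (Multiplicative (A ⧸ B)) := inferInstanceAs (Finite (A ⧸ B))
  have h : ψ.ker.FiniteIndex := inferInstance
  have := h.index_ne_zero
  rwa [← hker] at this

end CosetSum

/-! ### The chain of subgroups: trivial intersection and many fixed cosets. -/

section Chain

variable {A Λ : Type*} [AddCommGroup A] [Group Λ] (L : ℕ → Subgroup Λ) [∀ n, (L n).Normal]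
  (c : ℕ → Λ) (B : ℕ → AddSubgroup A)

/-- The intersection of the first `n` subgroups `cosetSumSubgroup (L k) (c k) (B k)`. -/
noncomputable def cosetSumChain (n : ℕ) : Subgroup (WreathProduct A Λ) :=
  ⨅ k ∈ Finset.range n, cosetSumSubgroup (L k) (c k) (B k)

theorem mem_cosetSumChain {n : ℕ} {a : WreathProduct A Λ} :
    a ∈ cosetSumChain L c B n ↔ ∀ k < n, a ∈ cosetSumSubgroup (L k) (c k) (B k) := by
  simp [cosetSumChain, Subgroup.mem_iInf]

theorem antitone_cosetSumChain : Antitone (cosetSumChain L c B) := fun _ _ hmn _ ha =>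
  (mem_cosetSumChain L c B).2 fun k hk => (mem_cosetSumChain L c B).1 ha k (hk.trans_le hmn)

instance finiteIndex_cosetSumChain [∀ n, (L n).FiniteIndex] [∀ n, (B n).FiniteIndex] (n : ℕ) :
    (cosetSumChain L c B n).FiniteIndex :=
  Subgroup.finiteIndex_iInf' (s := Finset.range n) _ fun k _ =>
    finiteIndex_cosetSumSubgroup (L k) (c k) (B k)

theorem iInf_cosetSumChain (hL : ∀ g, g ≠ 1 → ∀ᶠ n in Filter.atTop, g ∉ L n)
    (hc : ∀ x, ∃ᶠ k in Filter.atTop, c k = x)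
    (hB : ∀ a, a ≠ 0 → ∀ᶠ n in Filter.atTop, a ∉ B n) : ⨅ n, cosetSumChain L c B n = ⊥ := by
  refine (Subgroup.eq_bot_iff_forall _).2 fun a ha => ?_
  have ha' : ∀ k, a ∈ cosetSumSubgroup (L k) (c k) (B k) := fun k =>
    (mem_cosetSumChain L c B).1 (Subgroup.mem_iInf.1 ha (k + 1)) k (Nat.lt_succ_self k)
  have hr : a.right = 1 := by
    by_contra h
    obtain ⟨k, hk⟩ := (hL _ h).exists
    exact hk (ha' k).1
  have hl : a.left.toAdd = 0 := by
    refine Finsupp.ext fun x => ?_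
    by_contra hx
    have hev : ∀ᶠ k in Filter.atTop, ∀ y ∈ a.left.toAdd.support, y ≠ x → x⁻¹ * y ∉ L k := by
      rw [Filter.eventually_all_finset]
      intro y _
      by_cases hyx : y = x
      · simp [hyx]
      · filter_upwards [hL (x⁻¹ * y) fun h => hyx (inv_mul_eq_one.1 h).symm] with k hk _ using hk
    -- Choose `k` with `c k = x`, late enough that `x L k` meets the support only at `x` and `f x ∉
    -- B k`; the coset sum is then `f x`.
    obtain ⟨k, rfl, hk, hkB⟩ := ((hc x).and_eventually (hev.and (hB _ hx))).exists
    have := (ha' k).2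
    rw [cosetSum_eq_apply _ _ _ hk] at this
    exact hkB this
  exact SemidirectProduct.ext hl hr

/-- A coset `b H` is fixed exactly when `b⁻¹ g b ∈ H`. This conjugate is supported at `b.right⁻¹`,
so it can violate condition `k` only if `b.right` lies in one particular coset of `L k`. A union
bound over `k` finishes. -/
theorem le_ncard_fixed_cosetSumChain [∀ n, (L n).FiniteIndex] [∀ n, (B n).FiniteIndex]
    (hind : ∀ n, 2 ^ (n + 2) ≤ (L n).index) (a : A) (n : ℕ) :
    ((cosetSumChain L c B n).index : ℝ) / 2 ≤
      ({q : WreathProduct A Λ ⧸ cosetSumChain L c B n |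
        (SemidirectProduct.inl (Multiplicative.ofAdd (Finsupp.single 1 a)) :
          WreathProduct A Λ) • q = q}.ncard : ℝ) := by
  set H := cosetSumChain L c B n with hH
  set g : WreathProduct A Λ :=
    SemidirectProduct.inl (Multiplicative.ofAdd (Finsupp.single 1 a)) with hg
  have hle : ∀ k ∈ Finset.range n, H ≤ (L k).comap SemidirectProduct.rightHom := fun k hk x hx =>
    cosetSumSubgroup_le _ _ _ ((mem_cosetSumChain L c B).1 hx k (Finset.mem_range.1 hk))
  have hsub : {q : WreathProduct A Λ ⧸ H | g • q = q}ᶜ ⊆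
      ⋃ k ∈ Finset.range n, {q | ∃ hk : H ≤ (L k).comap SemidirectProduct.rightHom,
        Subgroup.quotientMapOfLE hk q =
          ((SemidirectProduct.inr (c k)⁻¹ : WreathProduct A Λ) : WreathProduct A Λ ⧸ _)} := by
    intro q hq
    obtain ⟨b, rfl⟩ := QuotientGroup.mk_surjective q
    have hconj : b⁻¹ * (g * b) =
        SemidirectProduct.inl (Multiplicative.ofAdd (Finsupp.single b.right⁻¹ a)) := by
      refine SemidirectProduct.ext ?_ ?_
      · simp [hg, mul_comm, MulEquiv.symm_apply_eq, wreathShift_single]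
      · simp [hg]
    have hn : b⁻¹ * (g * b) ∉ H := fun h => hq (QuotientGroup.eq.2 h).symm
    rw [hconj, hH, mem_cosetSumChain] at hn
    push Not at hn
    obtain ⟨k, hk, hkn⟩ := hn
    have hk' := Finset.mem_range.2 hk
    refine Set.mem_biUnion hk' ⟨hle k hk', ?_⟩
    rw [Subgroup.quotientMapOfLE_apply_mk, QuotientGroup.eq, Subgroup.mem_comap]
    simp only [map_mul, map_inv, SemidirectProduct.rightHom_inr,
      SemidirectProduct.rightHom_eq_right]
    by_contra hnot
    refine hkn ⟨by simp [(L k).one_mem], ?_⟩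
    -- Normality exchanges the two factors, matching the support condition with the coset of
    -- `b.right`.
    have hnot' : (c k)⁻¹ * b.right⁻¹ ∉ L k := fun h =>
      hnot ((inferInstance : (L k).Normal).mem_comm h)
    rw [SemidirectProduct.left_inl, toAdd_ofAdd, cosetSum_single, if_neg hnot']
    exact (B k).zero_mem
  have hcard : ({q : WreathProduct A Λ ⧸ H | g • q = q}ᶜ.ncard : ℝ) ≤
      ∑ k ∈ Finset.range n, (H.index : ℝ) * (1 / 2) ^ (k + 2) := by
    have h1 := (Set.ncard_le_ncard hsub (Set.toFinite _)).trans
      (Finset.set_ncard_biUnion_le _ _)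
    refine (Nat.cast_le.2 h1).trans ?_
    rw [Nat.cast_sum]
    refine (Finset.sum_le_sum fun k hk => ?_)
    have h2 := Subgroup.ncard_fiber_mul_index (hle k hk)
      ((SemidirectProduct.inr (c k)⁻¹ : WreathProduct A Λ) : WreathProduct A Λ ⧸ _)
    rw [index_comap_rightHom] at h2
    have h3 : {q : WreathProduct A Λ ⧸ H | ∃ hk : H ≤ (L k).comap SemidirectProduct.rightHom,
        Subgroup.quotientMapOfLE hk q =
          ((SemidirectProduct.inr (c k)⁻¹ : WreathProduct A Λ) : WreathProduct A Λ ⧸ _)}.ncard *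
        2 ^ (k + 2) ≤ H.index := by
      rw [← h2]
      simp only [exists_prop_of_true (hle k hk)]
      exact Nat.mul_le_mul_left _ (hind k)
    rw [one_div, inv_pow, ← div_eq_mul_inv, le_div_iff₀ (by positivity)]
    exact_mod_cast h3
  -- The shift by 2 in the exponent scales the geometric total 2 by 1/4.
  have hsum : ∑ k ∈ Finset.range n, (1 / 2 : ℝ) ^ (k + 2) ≤ 1 / 2 := by
    have := (summable_geometric_two).sum_le_tsum (Finset.range n) (fun _ _ => by positivity)
    rw [tsum_geometric_two] at this
    simp only [pow_add, ← Finset.sum_mul]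
    linarith
  rw [← Finset.mul_sum] at hcard
  have htot : ({q : WreathProduct A Λ ⧸ H | g • q = q}.ncard : ℝ) +
      ({q : WreathProduct A Λ ⧸ H | g • q = q}ᶜ.ncard : ℝ) = H.index := by
    rw [Subgroup.index_eq_card]
    exact_mod_cast Set.ncard_add_ncard_compl _
  have := mul_le_mul_of_nonneg_left hsum (Nat.cast_nonneg (α := ℝ) H.index)
  linarith

end Chain

/-! ### Choice of the data and conclusion. -/

theorem infinite_of_torsionFree {G : Type*} [Group G] [Nontrivial G]
    (htf : ∀ g : G, g ≠ 1 → ¬ IsOfFinOrder g) : Infinite G := by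
  obtain ⟨g, hg⟩ := exists_ne (1 : G)
  refine not_finite_iff_infinite.1 fun _ => htf g hg (isOfFinOrder_of_finite g)

/-- The vectors in `ℤ ^ d` all of whose coordinates are divisible by `n + 1`. -/
def multiplesSubgroup (d n : ℕ) : AddSubgroup (Fin d → ℤ) :=
  (AddMonoidHom.compLeft (Int.castAddHom (ZMod (n + 1))) (Fin d)).ker

/-- The modulus `n + 1` is never 0, so the target of the reduction map is finite. -/
instance (d n : ℕ) : (multiplesSubgroup d n).FiniteIndex :=
  inferInstanceAs (AddMonoidHom.ker _).FiniteIndex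

theorem eventually_notMem_multiplesSubgroup {d : ℕ} (a : Fin d → ℤ) (ha : a ≠ 0) :
    ∀ᶠ n in Filter.atTop, a ∉ multiplesSubgroup d n := by
  obtain ⟨i, hi⟩ := Function.ne_iff.1 ha
  filter_upwards [Filter.eventually_ge_atTop (a i).natAbs] with n hn hmem
  have h1 : ((a i : ℤ) : ZMod (n + 1)) = 0 := congrFun hmem i
  rw [ZMod.intCast_zmod_eq_zero_iff_dvd, Int.natCast_dvd] at h1
  have := Nat.le_of_dvd (Int.natAbs_pos.2 hi) h1
  omega

theorem exists_frequently_eq (α : Type*) [Countable α] [Nonempty α] :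
    ∃ c : ℕ → α, ∀ x, ∃ᶠ k in Filter.atTop, c k = x := by
  obtain ⟨f, hf⟩ := exists_surjective_nat α
  refine ⟨fun k => f k.unpair.1, fun x => Filter.frequently_atTop.2 fun N => ?_⟩
  obtain ⟨i, rfl⟩ := hf x
  -- The second component of the pairing is free, so each value recurs beyond any `N`.
  exact ⟨Nat.pair i N, Nat.right_le_pair i N, by simp⟩

theorem theorem1p1 {Λ : Type*} [Group Λ] [Nontrivial Λ] [Group.IsNilpotent Λ]
    (hfg : Group.FG Λ) (htf : ∀ g : Λ, g ≠ 1 → ¬ IsOfFinOrder g) (d : ℕ) (hd : 1 ≤ d) :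
    ∃ _ : MulAction (WreathProduct (Fin d → ℤ) Λ) (ℕ → Bool),
      ContinuousConstSMul (WreathProduct (Fin d → ℤ) Λ) (ℕ → Bool) ∧
      MulAction.IsMinimal (WreathProduct (Fin d → ℤ) Λ) (ℕ → Bool) ∧
      IsTopologicallyFree (WreathProduct (Fin d → ℤ) Λ) (ℕ → Bool) ∧
      IsProfiniteAction (WreathProduct (Fin d → ℤ) Λ) (ℕ → Bool) ∧
      ¬ IsAlmostFinite (WreathProduct (Fin d → ℤ) Λ) (ℕ → Bool) := by
  have hcount := Group.countable_of_fg hfg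
  have hinf := infinite_of_torsionFree htf
  obtain ⟨L, hLn, hLf, hLsep, hLind⟩ := exists_antitone_normal_finiteIndex Λ
    (Group.exists_normal_finiteIndex_notMem Λ hfg) fun n => 2 ^ (n + 2)
  obtain ⟨c, hc⟩ := exists_frequently_eq Λ
  have : Infinite (WreathProduct (Fin d → ℤ) Λ) :=
    Infinite.of_injective _ (SemidirectProduct.inr_injective (φ := wreathShift (Fin d → ℤ) Λ))
  have : Countable (Multiplicative (Λ →₀ (Fin d → ℤ))) :=
    inferInstanceAs (Countable (Λ →₀ (Fin d → ℤ)))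
  have : Countable (WreathProduct (Fin d → ℤ) Λ) :=
    SemidirectProduct.equivProd.injective.countable
  have ha : (Pi.single ⟨0, hd⟩ 1 : Fin d → ℤ) ≠ 0 := by simp
  refine exists_action_cantor_not_isAlmostFinite (cosetSumChain L c (multiplesSubgroup d))
    (antitone_cosetSumChain L c _)
    (iInf_cosetSumChain L c _ hLsep hc eventually_notMem_multiplesSubgroup) ?_
    (le_ncard_fixed_cosetSumChain L c _ hLind (Pi.single ⟨0, hd⟩ 1))
  rw [Ne, map_eq_one_iff _ SemidirectProduct.inl_injective, ofAdd_eq_one]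
  simp
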